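/- Let $\mathbb K$ be an arbitrary field (of any characteristic, not necessarily algebraically closed), let $\lambda\in\mathbb K$, $\ell\ge 1$, and let $k_1,\dots,k_\ell\ge 1$ and $r_1>r_2>\dots>r_\ell\ge 1$ be integers. Let $J_{\lambda,r}$ denote the $r\times r$ Jordan block with eigenvalue $\lambda$ (ones on the superdiagonal), and let $$J_\lambda=\bigoplus_{i=1}^{\ell}k_iJ_{\lambda,r_i},\qquad k_iJ_{\lambda,r_i}=\underbrace{J_{\lambda,r_i}\oplus\cdots\oplus J_{\lambda,r_i}}_{k_i}.$$ Index the rows of $J_\lambda$ by the set $\Lambda$ of triples $(i_1,i_2,i_3)$ with $1\le i_1\le\ell$, $1\le i_2\le k_{i_1}$, $1\le i_3\le r_{i_1}$, where $(i_1,i_2,i_3)$ is the $i_3$-th row of the $i_2$-th block of size $r_{i_1}$. Let $R=\mathbb K[x(\boldsymbol i)\mid \boldsymbol i\in\Lambda]$, let $\boldsymbol x$ be the column vector of the variables, and let $I_\lambda\subseteq R$ be the ideal generated by the $2\times 2$ minors of the two-column matrix $(J_\lambda\boldsymbol x\mid\boldsymbol x)$. For $j\in\{1,\dots,\ell\}$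 put $$\Lambda_j=\{\boldsymbol i\in\Lambda\mid i_1\le j\},\quad \Lambda_{j,1}=\{\boldsymbol i\in\Lambda_j\mid i_3\ge r_j+1\},\quad \Lambda_{j,2}=\Lambda\setminus\Lambda_j,\quad \Theta_j=\{\boldsymbol i\in\Lambda_j\mid i_3=1\},$$ $$I_j=\langle x(\boldsymbol i)\mid\boldsymbol i\in\Lambda_{j,1}\cup\Lambda_{j,2}\rangle,\qquad \mathfrak q_{\lambda,j}=I_\lambda+I_j,\qquad \mathfrak h_j=\langle x(\boldsymbol i)\mid\boldsymbol i\in\Lambda\setminus\Theta_j\rangle .$$ Then $$I_\lambda=\bigcap_{j=1}^{\ell}\mathfrak q_{\lambda,j},$$ and for every $j\in\{1,\dots,\ell\}$ the ideal $\mathfrak q_{\lambda,j}$ is primary with radical $\sqrt{\mathfrak q_{\lambda,j}}=\mathfrak h_j$. In particular, the displayed intersection is a primary decomposition of $I_\lambda$. -/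

import Mathlib

namespace Eigenscheme

open MvPolynomial

section Ideal

/-- The augmented matrix `(A x | x)`, where `x` is the column vector of the variables of the
polynomial ring `K[x_i | i ∈ n]`. -/
noncomputable def augmented {K n : Type*} [Field K] [Fintype n] (A : Matrix n n K) :
    Matrix n (Fin 2) (MvPolynomial n K) :=
  Matrix.of fun i => ![((A.map C).mulVec (X : n → MvPolynomial n K)) i, X i]

/-- The ideal `I_A` generated by the `2 × 2` minors of `(A x | x)`. The rows of a minor run over
all ordered pairs `(i, j)`; the pairs with `i = j` contribute the generator `0`, and the pairs
`(i, j)` and `(j, i)` give the same minor up to sign. -/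
noncomputable def minorIdeal {K n : Type*} [Field K] [Fintype n] (A : Matrix n n K) :
    Ideal (MvPolynomial n K) :=
  Ideal.span {f | ∃ i j : n, f = ((augmented A).submatrix ![i, j] id).det}

end Ideal

section Jordan

/-- The Jordan block of size `r` with eigenvalue `c` (ones on the superdiagonal). -/
def jordanBlock {K : Type*} [Field K] (c : K) (r : ℕ) : Matrix (Fin r) (Fin r) K :=
  Matrix.of fun a b => if a = b then c else if (a : ℕ) + 1 = (b : ℕ) then 1 else 0

/-- The index set `Λ` of rows and variables: `⟨⟨i₁, i₂⟩, i₃⟩` is the row `i₃` of the `i₂`-th copy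
of the Jordan block of size `r i₁`. All indices are counted from `0`. -/
abbrev Idx {l : ℕ} (k r : Fin l → ℕ) : Type :=
  (p : (i : Fin l) × Fin (k i)) × Fin (r p.1)

/-- The Jordan matrix with the single eigenvalue `c` that has `k i` blocks of size `r i`. -/
def jordanMatrix {K : Type*} [Field K] (c : K) {l : ℕ} (k r : Fin l → ℕ) :
    Matrix (Idx k r) (Idx k r) K :=
  Matrix.blockDiagonal' fun p : (i : Fin l) × Fin (k i) => jordanBlock c (r p.1)

/-- `Λ_j`: the indices belonging to blocks of one of the sizes `r 0, …, r j`. -/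
def lam {l : ℕ} (k r : Fin l → ℕ) (j : Fin l) : Set (Idx k r) :=
  {a | a.1.1 ≤ j}

/-- `Λ_{j,1}`: the indices in `Λ_j` whose row number within the block, counted from `1`, is at
least `r j + 1`. -/
def lam₁ {l : ℕ} (k r : Fin l → ℕ) (j : Fin l) : Set (Idx k r) :=
  {a | a ∈ lam k r j ∧ r j + 1 ≤ (a.2 : ℕ) + 1}

/-- `Λ_{j,2} = Λ \ Λ_j`. -/
def lam₂ {l : ℕ} (k r : Fin l → ℕ) (j : Fin l) : Set (Idx k r) :=
  (lam k r j)ᶜ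

/-- `Θ_j`: the indices of the first rows of the blocks of sizes `r 0, …, r j`. -/
def theta {l : ℕ} (k r : Fin l → ℕ) (j : Fin l) : Set (Idx k r) :=
  {a | a.1.1 ≤ j ∧ (a.2 : ℕ) = 0}

/-- The ideal generated by the variables with index in `S`. -/
noncomputable def varIdeal (K : Type*) [Field K] {n : Type*} (S : Set n) :
    Ideal (MvPolynomial n K) :=
  Ideal.span ((X : n → MvPolynomial n K) '' S)

/-- `I_j = I_{j,1} + I_{j,2}`. -/
noncomputable def idealI (K : Type*) [Field K] {l : ℕ} (k r : Fin l → ℕ) (j : Fin l) :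
    Ideal (MvPolynomial (Idx k r) K) :=
  varIdeal K (lam₁ k r j) + varIdeal K (lam₂ k r j)

/-- `𝔮_{c,j} = I_c + I_j`, where `I_c` is the ideal of the Jordan matrix. -/
noncomputable def idealQ {K : Type*} [Field K] (c : K) {l : ℕ} (k r : Fin l → ℕ) (j : Fin l) :
    Ideal (MvPolynomial (Idx k r) K) :=
  minorIdeal (jordanMatrix c k r) + idealI K k r j

/-- `𝔥_j`, generated by the variables with index outside `Θ_j`. -/
noncomputable def idealH (K : Type*) [Field K] {l : ℕ} (k r : Fin l → ℕ) (j : Fin l) :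
    Ideal (MvPolynomial (Idx k r) K) :=
  varIdeal K (theta k r j)ᶜ

end Jordan

end Eigenscheme

/-!
Over the family of Jordan blocks, the minors of `(J x | x)` are the relations
`x(p, a + 1) x(q, b) = x(p, a) x(q, b + 1)`, where `x(p, a)` is read as `0` below the last row of
the block `p`. Modulo them, row numbers can be moved freely between the factors of a monomial, so
that a monomial is determined by the blocks it meets, with multiplicity, and by the sum of its row
numbers. The substitution `x(p, a) ↦ y_p ε ^ a`, with `x(p, a) ↦ 0` for all blocks outside a set
`T`, records exactly these data. If all blocks in `T` have size at least `n`, the substitution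
respects the relations modulo `ε ^ n`, and the preimage of `(ε ^ n)` is the component belonging to
`T` and `n`; it is primary because `ε` is prime. Finally, a monomial with row sum `b` vanishes
modulo the relations as soon as it meets a block of size at most `b`, and otherwise its coefficient
is seen by the component belonging to the smallest block it meets.
-/

namespace Eigenscheme

open MvPolynomial

section PrimePower

variable {A : Type*} [CommRing A] {x : A} {n : ℕ}

lemma isPrimary_span_pow_of_prime [IsDomain A] (hx : Prime x) (hn : n ≠ 0) :
    (Ideal.span {x ^ n}).IsPrimary := by
  rw [Ideal.isPrimary_iff]
  refine ⟨fun h => hx.not_isUnit ?_, fun {y z} h => ?_⟩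
  · exact (isUnit_pow_iff hn).1 (Ideal.span_singleton_eq_top.1 h)
  · by_cases hz : x ∣ z
    · exact .inr ⟨n, Ideal.mem_span_singleton.2 (pow_dvd_pow_of_dvd hz n)⟩
    · exact .inl <| Ideal.mem_span_singleton.2 <|
        hx.pow_dvd_of_dvd_mul_right n hz (Ideal.mem_span_singleton.1 h)

lemma radical_span_pow_of_prime (hx : Prime x) (hn : n ≠ 0) :
    (Ideal.span {x ^ n}).radical = Ideal.span {x} := by
  rw [← Ideal.span_singleton_pow, Ideal.radical_pow _ hn]
  exact ((Ideal.span_singleton_prime hx.ne_zero).2 hx).radical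

end PrimePower

lemma mem_of_fiberwise {R σ τ : Type*} [CommRing R] [DecidableEq τ]
    {J : Ideal (MvPolynomial σ R)} {μ : (σ →₀ ℕ) → τ} {f : MvPolynomial σ R}
    (hcongr : ∀ m n, μ m = μ n → (monomial m 1 - monomial n 1 : MvPolynomial σ R) ∈ J)
    (hf : ∀ m ∈ f.support, (monomial m 1 : MvPolynomial σ R) ∈ J ∨
      ∑ n ∈ f.support with μ n = μ m, f.coeff n = 0) :
    f ∈ J := by
  rw [f.as_sum, ← Finset.sum_fiberwise_of_maps_to fun m => Finset.mem_image_of_mem μ]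
  refine J.sum_mem fun t ht => ?_
  obtain ⟨m, hm, rfl⟩ := Finset.mem_image.1 ht
  have hmonomial : ∀ n, monomial n (f.coeff n) =
      C (f.coeff n) * (monomial n 1 - monomial m 1) + C (f.coeff n) * monomial m 1 := fun n => by
    rw [mul_sub, sub_add_cancel, C_mul_monomial, mul_one]
  simp only [hmonomial, Finset.sum_add_distrib, ← Finset.sum_mul, ← map_sum]
  refine J.add_mem (J.sum_mem fun n hn => J.mul_mem_left _ ?_) ?_
  · exact hcongr n m (Finset.mem_filter.1 hn).2
  · rcases hf m hm with hmem | hsum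
    · exact J.mul_mem_left _ hmem
    · simp [hsum]

section Shift

variable {P : Type*} {s : P → ℕ} {R : Type*} [CommRing R]

variable (s R) in
/-- The variable in row `a` of the block `p` of size `s p`, with the value `0` below the last row.
Thus multiplication by a nilpotent Jordan block sends the row variable `a` to the row variable
`a + 1` without exception. -/
noncomputable def rowVar (p : P) (a : ℕ) : MvPolynomial (Σ p, Fin (s p)) R :=
  if h : a < s p then X ⟨p, a, h⟩ else 0

variable (s R) in
/-- The ideal of the relations by which one unit of row number moves from one factor of a product
of row variables to another. It is the ideal of minors of a Jordan matrix with blocks of sizes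
`s p`; here `R` and the set `P` of blocks are arbitrary. -/
noncomputable def shiftIdeal : Ideal (MvPolynomial (Σ p, Fin (s p)) R) :=
  Ideal.span {f | ∃ p q a b,
    f = rowVar s R p (a + 1) * rowVar s R q b - rowVar s R p a * rowVar s R q (b + 1)}

/-- The blocks met by a monomial, with multiplicities. -/
noncomputable def blocks : ((Σ p, Fin (s p)) →₀ ℕ) →+ (P →₀ ℕ) :=
  Finsupp.mapDomain.addMonoidHom Sigma.fst

/-- The sum of the row numbers, counted from `0`, of the factors of a monomial. -/
noncomputable def height : ((Σ p, Fin (s p)) →₀ ℕ) →+ ℕ :=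
  Finsupp.weight fun i => (i.2 : ℕ)

lemma rowVar_val (i : Σ p, Fin (s p)) : rowVar s R i.1 i.2 = X i := by
  simp [rowVar]

lemma rowVar_of_le {p : P} {a : ℕ} (h : s p ≤ a) : rowVar s R p a = 0 := by
  simp [rowVar, h]

lemma rowVar_mem {J : Ideal (MvPolynomial (Σ p, Fin (s p)) R)} {p : P} {a : ℕ}
    (h : ∀ ha : a < s p, X ⟨p, a, ha⟩ ∈ J) : rowVar s R p a ∈ J := by
  unfold rowVar
  split_ifs with ha
  · exact h ha
  · exact J.zero_mem

@[simp]
lemma blocks_single (i : Σ p, Fin (s p)) (e : ℕ) :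
    blocks (Finsupp.single i e) = Finsupp.single i.1 e :=
  Finsupp.mapDomain_single

@[simp]
lemma height_single (i : Σ p, Fin (s p)) (e : ℕ) : height (Finsupp.single i e) = e * i.2 :=
  Finsupp.weight_single _ i e

lemma mem_support_blocks {m : (Σ p, Fin (s p)) →₀ ℕ} {p : P} :
    p ∈ (blocks m).support ↔ ∃ i ∈ m.support, i.1 = p := by
  classical
  rw [blocks, Finsupp.mapDomain.addMonoidHom_apply,
    Finsupp.mapDomain_support_of_subsingletonAddUnits, Finset.mem_image]

lemma blocks_eq_zero_iff {m : (Σ p, Fin (s p)) →₀ ℕ} : blocks m = 0 ↔ m = 0 := by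
  refine ⟨fun h => ?_, fun h => h ▸ map_zero _⟩
  rw [← Finsupp.support_eq_empty, Finset.eq_empty_iff_forall_notMem]
  intro i hi
  simpa [h] using mem_support_blocks.2 ⟨i, hi, rfl⟩

section Quotient

variable {J : Ideal (MvPolynomial (Σ p, Fin (s p)) R)}

lemma mk_rowVar_mul_rowVar (hJ : shiftIdeal s R ≤ J) (p q : P) (a b : ℕ) :
    Ideal.Quotient.mk J (rowVar s R p a * rowVar s R q b) =
      Ideal.Quotient.mk J (rowVar s R p (a + b) * rowVar s R q 0) := by
  induction b generalizing a with
  | zero => rfl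
  | succ b ih =>
    have hshift : Ideal.Quotient.mk J (rowVar s R p (a + 1) * rowVar s R q b) =
        Ideal.Quotient.mk J (rowVar s R p a * rowVar s R q (b + 1)) :=
      Ideal.Quotient.eq.2 (hJ (Ideal.subset_span ⟨p, q, a, b, rfl⟩))
    rw [← hshift, ih, Nat.add_right_comm, add_assoc]

variable (s R) in
/-- The product of the first row variables of a multiset of blocks. -/
noncomputable def firstRows (d : P →₀ ℕ) : MvPolynomial (Σ p, Fin (s p)) R :=
  d.prod fun p e => rowVar s R p 0 ^ e

lemma firstRows_add (d d' : P →₀ ℕ) :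
    firstRows s R (d + d') = firstRows s R d * firstRows s R d' := by
  exact Finsupp.prod_add_index' (fun _ => pow_zero _) fun _ _ _ => pow_add _ _ _

lemma mk_rowVar_mul_monomial (hJ : shiftIdeal s R ≤ J) (p : P) (a : ℕ)
    (m : (Σ p, Fin (s p)) →₀ ℕ) :
    Ideal.Quotient.mk J (rowVar s R p a * monomial m 1) =
      Ideal.Quotient.mk J (rowVar s R p (a + height m) * firstRows s R (blocks m)) := by
  induction m using Finsupp.induction_linear generalizing a with
  | zero => simp [firstRows]
  | add m n hm hn =>
    have hsplit : (monomial (m + n) 1 : MvPolynomial (Σ p, Fin (s p)) R) =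
        monomial m 1 * monomial n 1 := by simp
    rw [hsplit, ← mul_assoc, map_mul, hm, ← map_mul, mul_right_comm, map_mul, hn, ← map_mul,
      map_add, map_add, firstRows_add, add_assoc, mul_assoc, mul_comm (firstRows s R _)]
  | single i e =>
    induction e generalizing a with
    | zero => simp [firstRows]
    | succ e ih =>
      have hsplit : (monomial (Finsupp.single i (e + 1)) 1 : MvPolynomial (Σ p, Fin (s p)) R) =
          rowVar s R i.1 i.2 * monomial (Finsupp.single i e) 1 := by
        rw [rowVar_val, add_comm, X, monomial_mul, Finsupp.single_add, mul_one]
      rw [hsplit, ← mul_assoc, map_mul, mk_rowVar_mul_rowVar hJ, ← map_mul, mul_right_comm, map_mul,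
        ih, ← map_mul, Finsupp.single_add, map_add, map_add, firstRows_add, height_single i 1,
        blocks_single i 1]
      simp [firstRows, add_comm, add_assoc, mul_assoc]

lemma mk_monomial (hJ : shiftIdeal s R ≤ J) {m : (Σ p, Fin (s p)) →₀ ℕ} {p : P}
    (hp : p ∈ (blocks m).support) :
    Ideal.Quotient.mk J (monomial m 1) = Ideal.Quotient.mk J
      (rowVar s R p (height m) * firstRows s R (blocks m - Finsupp.single p 1)) := by
  obtain ⟨i, hi, rfl⟩ := mem_support_blocks.1 hp
  obtain ⟨m, rfl⟩ : ∃ m', m = Finsupp.single i 1 + m' :=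
    ⟨m - Finsupp.single i 1, by
      rw [add_comm, Finsupp.sub_add_single_one_cancel (Finsupp.mem_support_iff.1 hi)]⟩
  have hsplit : (monomial (Finsupp.single i 1 + m) 1 : MvPolynomial (Σ p, Fin (s p)) R) =
      rowVar s R i.1 i.2 * monomial m 1 := by
    rw [rowVar_val, X, monomial_mul, mul_one]
  rw [hsplit, mk_rowVar_mul_monomial hJ]
  simp

lemma monomial_sub_monomial_mem (hJ : shiftIdeal s R ≤ J) {m n : (Σ p, Fin (s p)) →₀ ℕ}
    (hblocks : blocks m = blocks n) (hheight : height m = height n) :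
    (monomial m 1 - monomial n 1 : MvPolynomial (Σ p, Fin (s p)) R) ∈ J := by
  rcases (blocks m).support.eq_empty_or_nonempty with hempty | ⟨p, hp⟩
  · rw [Finsupp.support_eq_empty] at hempty
    have hm : m = 0 := blocks_eq_zero_iff.1 hempty
    have hn : n = 0 := blocks_eq_zero_iff.1 (hblocks ▸ hempty)
    simp [hm, hn]
  · rw [← Ideal.Quotient.eq, mk_monomial hJ hp, mk_monomial hJ (hblocks ▸ hp), hblocks, hheight]

lemma monomial_mem_of_rowVar_mem (hJ : shiftIdeal s R ≤ J) {m : (Σ p, Fin (s p)) →₀ ℕ} {p : P}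
    (hp : p ∈ (blocks m).support) (hrow : rowVar s R p (height m) ∈ J) :
    (monomial m 1 : MvPolynomial (Σ p, Fin (s p)) R) ∈ J := by
  rw [← Ideal.Quotient.eq_zero_iff_mem, mk_monomial hJ hp, Ideal.Quotient.eq_zero_iff_mem]
  exact J.mul_mem_right _ hrow

end Quotient

open Classical in
variable (s R) in
/-- The substitution `x(p, a) ↦ y_p ε ^ a` on the blocks in `T`; the variables of all other blocks
are sent to `0`. -/
noncomputable def param (T : Set P) :
    MvPolynomial (Σ p, Fin (s p)) R →ₐ[R] Polynomial (MvPolynomial P R) :=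
  aeval fun i => if i.1 ∈ T then Polynomial.C (X i.1) * Polynomial.X ^ (i.2 : ℕ) else 0

open Classical in
lemma param_X (T : Set P) (i : Σ p, Fin (s p)) :
    param s R T (X i) =
      if i.1 ∈ T then Polynomial.C (X i.1) * Polynomial.X ^ (i.2 : ℕ) else 0 :=
  aeval_X _ _

variable (s R) in
/-- The ideal of polynomials that vanish modulo `ε ^ n` under the substitution `param s R T`. -/
noncomputable def truncIdeal (T : Set P) (n : ℕ) : Ideal (MvPolynomial (Σ p, Fin (s p)) R) :=
  (Ideal.span {Polynomial.X ^ n}).comap (param s R T)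

variable {T : Set P} {n : ℕ}

lemma prod_C_X_mul_X_pow (m : (Σ p, Fin (s p)) →₀ ℕ) :
    (m.prod fun i e => (Polynomial.C (X i.1 : MvPolynomial P R) * Polynomial.X ^ (i.2 : ℕ)) ^ e) =
      Polynomial.monomial (height m) (monomial (blocks m) 1) := by
  induction m using Finsupp.induction_linear with
  | zero => simp
  | add m n hm hn =>
    rw [Finsupp.prod_add_index' (fun _ => pow_zero _) (fun _ _ _ => pow_add _ _ _), hm, hn,
      Polynomial.monomial_mul_monomial, monomial_mul, one_mul, map_add, map_add]
  | single i e =>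
    rw [Finsupp.prod_single_index (by exact pow_zero _), Polynomial.C_mul_X_pow_eq_monomial,
      Polynomial.monomial_pow, X_pow_eq_monomial, blocks_single, height_single, mul_comm]

open Classical in
lemma param_monomial (m : (Σ p, Fin (s p)) →₀ ℕ) (a : R) :
    param s R T (monomial m a) = if ↑(blocks m).support ⊆ T then
      Polynomial.monomial (height m) (monomial (blocks m) a) else 0 := by
  rw [param, aeval_monomial]
  split_ifs with h
  · rw [← mul_one a, ← C_mul_monomial, ← Polynomial.C_mul_monomial, mul_one, ← prod_C_X_mul_X_pow]
    congr 1
    exact Finsupp.prod_congr fun i hi => by rw [if_pos (h (mem_support_blocks.2 ⟨i, hi, rfl⟩))]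
  · obtain ⟨p, hp, hpT⟩ := Set.not_subset.1 h
    obtain ⟨i, hi, rfl⟩ := mem_support_blocks.1 hp
    rw [Finsupp.prod, Finset.prod_eq_zero hi, mul_zero]
    rw [if_neg hpT, zero_pow (Finsupp.mem_support_iff.1 hi)]

open Classical in
lemma coeff_param (f : MvPolynomial (Σ p, Fin (s p)) R) {d : P →₀ ℕ} (hd : ↑d.support ⊆ T)
    (b : ℕ) : ((param s R T f).coeff b).coeff d =
      ∑ m ∈ f.support with (blocks m, height m) = (d, b), f.coeff m := by
  conv_lhs => rw [f.as_sum]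
  rw [map_sum, Polynomial.finsetSum_coeff, coeff_sum, Finset.sum_filter]
  refine Finset.sum_congr rfl fun m _ => ?_
  by_cases hm : blocks m = d
  · subst hm
    rw [param_monomial, if_pos hd, Polynomial.coeff_monomial]
    by_cases hb : height m = b <;> simp [hb]
  · rw [if_neg fun h => hm (congrArg Prod.fst h), param_monomial]
    split_ifs
    · rw [Polynomial.coeff_monomial]
      split_ifs <;> simp [hm]
    · simp

lemma X_mem_truncIdeal {i : Σ p, Fin (s p)} (h : i.1 ∈ T → n ≤ i.2) :
    X i ∈ truncIdeal s R T n := by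
  rw [truncIdeal, Ideal.mem_comap, param_X]
  split_ifs with hi
  · exact Ideal.mul_mem_left _ _ (Ideal.mem_span_singleton.2 (pow_dvd_pow _ (h hi)))
  · exact Ideal.zero_mem _

open Classical in
lemma mk_param_rowVar (hT : ∀ p ∈ T, n ≤ s p) (p : P) (a : ℕ) :
    Ideal.Quotient.mk (Ideal.span {Polynomial.X ^ n}) (param s R T (rowVar s R p a)) =
      Ideal.Quotient.mk (Ideal.span {Polynomial.X ^ n})
        (if p ∈ T then Polynomial.C (X p) * Polynomial.X ^ a else 0) := by
  by_cases ha : a < s p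
  · rw [rowVar, dif_pos ha, param_X]
  · rw [rowVar_of_le (not_lt.1 ha), map_zero, map_zero, eq_comm, Ideal.Quotient.eq_zero_iff_mem]
    split_ifs with hp
    · exact Ideal.mul_mem_left _ _
        (Ideal.mem_span_singleton.2 (pow_dvd_pow _ ((hT p hp).trans (not_lt.1 ha))))
    · exact Ideal.zero_mem _

lemma shiftIdeal_le_truncIdeal (hT : ∀ p ∈ T, n ≤ s p) :
    shiftIdeal s R ≤ truncIdeal s R T n := by
  refine Ideal.span_le.2 ?_
  rintro _ ⟨p, q, a, b, rfl⟩
  rw [SetLike.mem_coe, truncIdeal, Ideal.mem_comap, map_sub, ← Ideal.Quotient.eq]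
  simp only [map_mul, mk_param_rowVar hT]
  rw [← map_mul, ← map_mul]
  congr 1
  split_ifs <;> ring

lemma mem_of_forall_monomial_mem_or_mem_truncIdeal {J : Ideal (MvPolynomial (Σ p, Fin (s p)) R)}
    (hJ : shiftIdeal s R ≤ J) {f : MvPolynomial (Σ p, Fin (s p)) R}
    (hf : ∀ m : (Σ p, Fin (s p)) →₀ ℕ, (monomial m 1 : MvPolynomial (Σ p, Fin (s p)) R) ∈ J ∨
      ∃ (T : Set P) (n : ℕ), ↑(blocks m).support ⊆ T ∧ height m < n ∧ f ∈ truncIdeal s R T n) :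
    f ∈ J := by
  classical
  refine mem_of_fiberwise (μ := fun m => (blocks m, height m))
    (fun m n h => monomial_sub_monomial_mem hJ (congrArg Prod.fst h) (congrArg Prod.snd h))
    fun m _ => (hf m).imp_right ?_
  rintro ⟨T, n, hmT, hmn, hfT⟩
  have hdvd : Polynomial.X ^ n ∣ param s R T f := Ideal.mem_span_singleton.1 hfT
  rw [← coeff_param f hmT, Polynomial.X_pow_dvd_iff.1 hdvd _ hmn, coeff_zero]

lemma truncIdeal_le {J : Ideal (MvPolynomial (Σ p, Fin (s p)) R)} (hJ : shiftIdeal s R ≤ J)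
    (hn : n ≠ 0) (hX : ∀ i : Σ p, Fin (s p), (i.1 ∈ T → n ≤ i.2) → X i ∈ J) :
    truncIdeal s R T n ≤ J := by
  refine fun f hf => mem_of_forall_monomial_mem_or_mem_truncIdeal hJ fun m => ?_
  by_cases hm : ∃ p ∈ (blocks m).support, p ∈ T → n ≤ height m
  · obtain ⟨p, hp, hpn⟩ := hm
    exact .inl (monomial_mem_of_rowVar_mem hJ hp (rowVar_mem fun ha => hX _ hpn))
  · push Not at hm
    refine .inr ⟨T, n, fun p hp => (hm p hp).1, ?_, hf⟩
    rcases (blocks m).support.eq_empty_or_nonempty with hempty | ⟨p, hp⟩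
    · rw [Finsupp.support_eq_empty, blocks_eq_zero_iff] at hempty
      simpa [hempty] using Nat.pos_of_ne_zero hn
    · exact (hm p hp).2

lemma truncIdeal_eq (hn : n ≠ 0) (hT : ∀ p ∈ T, n ≤ s p) :
    truncIdeal s R T n =
      shiftIdeal s R ⊔ Ideal.span (X '' {i | i.1 ∈ T → n ≤ i.2}) := by
  refine le_antisymm (truncIdeal_le le_sup_left hn fun i hi => ?_)
    (sup_le (shiftIdeal_le_truncIdeal hT) (Ideal.span_le.2 ?_))
  · exact Ideal.mem_sup_right (Ideal.subset_span (Set.mem_image_of_mem X hi))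
  · rintro _ ⟨i, hi, rfl⟩
    exact X_mem_truncIdeal hi

lemma truncIdeal_one :
    truncIdeal s R T 1 = Ideal.span (X '' {i | i.1 ∈ T → 1 ≤ (i.2 : ℕ)}) := by
  have hrow : ∀ p a, rowVar s R p (a + 1) ∈
      Ideal.span (X '' {i : Σ p, Fin (s p) | i.1 ∈ T → 1 ≤ (i.2 : ℕ)}) := fun p a =>
    rowVar_mem fun ha => Ideal.subset_span (Set.mem_image_of_mem X fun _ => Nat.le_add_left 1 a)
  refine le_antisymm (truncIdeal_le (Ideal.span_le.2 ?_) one_ne_zero fun i hi => ?_)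
    (Ideal.span_le.2 ?_)
  · rintro _ ⟨p, q, a, b, rfl⟩
    exact Ideal.sub_mem _ (Ideal.mul_mem_right _ _ (hrow p a)) (Ideal.mul_mem_left _ _ (hrow q b))
  · exact Ideal.subset_span (Set.mem_image_of_mem X hi)
  · rintro _ ⟨i, hi, rfl⟩
    exact X_mem_truncIdeal hi

lemma isPrimary_truncIdeal [IsDomain R] (hn : n ≠ 0) : (truncIdeal s R T n).IsPrimary :=
  (isPrimary_span_pow_of_prime Polynomial.prime_X hn).comap (param s R T).toRingHom

lemma radical_truncIdeal [IsDomain R] (hn : n ≠ 0) :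
    (truncIdeal s R T n).radical = truncIdeal s R T 1 := by
  rw [truncIdeal, truncIdeal, ← Ideal.comap_radical,
    radical_span_pow_of_prime Polynomial.prime_X hn, pow_one]

lemma iInf_truncIdeal {ι : Type*} [Nonempty ι] {T : ι → Set P} {n : ι → ℕ} (hn : ∀ j, n j ≠ 0)
    (hT : ∀ j, ∀ p ∈ T j, n j ≤ s p)
    (hcover : ∀ S : Finset P, S.Nonempty → ∃ j, ↑S ⊆ T j ∧ ∃ p ∈ S, s p ≤ n j) :
    ⨅ j, truncIdeal s R (T j) (n j) = shiftIdeal s R := by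
  refine le_antisymm (fun f hf => ?_) (le_iInf fun j => shiftIdeal_le_truncIdeal (hT j))
  rw [Submodule.mem_iInf] at hf
  refine mem_of_forall_monomial_mem_or_mem_truncIdeal le_rfl fun m => ?_
  rcases (blocks m).support.eq_empty_or_nonempty with hempty | hnonempty
  · obtain ⟨j⟩ := ‹Nonempty ι›
    refine .inr ⟨T j, n j, by simp [hempty], ?_, hf j⟩
    rw [Finsupp.support_eq_empty, blocks_eq_zero_iff] at hempty
    simpa [hempty] using Nat.pos_of_ne_zero (hn j)
  · obtain ⟨j, hsub, p, hp, hpn⟩ := hcover _ hnonempty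
    by_cases hlt : height m < n j
    · exact .inr ⟨T j, n j, hsub, hlt, hf j⟩
    · refine .inl (monomial_mem_of_rowVar_mem le_rfl hp ?_)
      rw [rowVar_of_le (hpn.trans (not_lt.1 hlt))]
      exact Ideal.zero_mem _

end Shift

section Jordan

lemma blockDiagonal'_mulVec {o A : Type*} [Fintype o] [DecidableEq o] [NonUnitalNonAssocSemiring A]
    {m n : o → Type*} [∀ i, Fintype (n i)] (M : ∀ i, Matrix (m i) (n i) A)
    (v : (Σ i, n i) → A) (i : Σ i, m i) :
    (Matrix.blockDiagonal' M).mulVec v i = (M i.1).mulVec (fun b => v ⟨i.1, b⟩) i.2 := by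
  obtain ⟨i, a⟩ := i
  simp only [Matrix.mulVec, dotProduct]
  rw [Fintype.sum_sigma, Fintype.sum_eq_single i]
  · simp only [Matrix.blockDiagonal'_apply_eq]
  · intro j hj
    simp [Matrix.blockDiagonal'_apply_ne M _ _ hj.symm]

variable {K : Type*} [Field K]

lemma jordanBlock_map_mulVec {A : Type*} [CommRing A] (φ : K →+* A) (c : K) {r : ℕ}
    (v : Fin r → A) (a : Fin r) :
    ((jordanBlock c r).map φ).mulVec v a =
      φ c * v a + if h : (a : ℕ) + 1 < r then v ⟨a + 1, h⟩ else 0 := by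
  have hentry : ∀ b, φ (jordanBlock c r a b) * v b =
      (if a = b then φ c * v b else 0) + if (a : ℕ) + 1 = b then v b else 0 := by
    intro b
    by_cases hab : a = b
    · simp [jordanBlock, hab]
    · by_cases hab' : (a : ℕ) + 1 = b <;> simp [jordanBlock, hab, hab']
  simp only [Matrix.mulVec, dotProduct, Matrix.map_apply, hentry, Finset.sum_add_distrib,
    Fintype.sum_ite_eq]
  congr 1
  split_ifs with h
  · rw [Fintype.sum_eq_single ⟨a + 1, h⟩ fun b hb => if_neg fun hab => hb (Fin.ext hab.symm),
      if_pos rfl]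
  · exact Fintype.sum_eq_zero _ fun b => if_neg (by lia)

variable {l : ℕ} {k r : Fin l → ℕ}

variable (k r) in
/-- The sizes of the blocks of `jordanMatrix c k r`. -/
abbrev blockSize (p : (i : Fin l) × Fin (k i)) : ℕ :=
  r p.1

lemma jordanMatrix_map_mulVec_X (c : K) (i : Idx k r) :
    ((jordanMatrix c k r).map C).mulVec X i =
      C c * X i + rowVar (blockSize k r) K i.1 (i.2 + 1) := by
  rw [jordanMatrix, Matrix.blockDiagonal'_map _ _ (map_zero C), blockDiagonal'_mulVec,
    jordanBlock_map_mulVec]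
  rfl

lemma det_augmented_jordanMatrix (c : K) (i j : Idx k r) :
    ((augmented (jordanMatrix c k r)).submatrix ![i, j] id).det =
      rowVar (blockSize k r) K i.1 (i.2 + 1) * X j -
        X i * rowVar (blockSize k r) K j.1 (j.2 + 1) := by
  rw [Matrix.det_fin_two]
  simp only [augmented, Matrix.submatrix_apply, Matrix.of_apply, id, Matrix.cons_val_zero,
    Matrix.cons_val_one, jordanMatrix_map_mulVec_X]
  ring

lemma minorIdeal_jordanMatrix (c : K) :
    minorIdeal (jordanMatrix c k r) = shiftIdeal (blockSize k r) K := by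
  refine le_antisymm (Ideal.span_le.2 ?_) (Ideal.span_le.2 ?_)
  · rintro _ ⟨i, j, rfl⟩
    rw [det_augmented_jordanMatrix, ← rowVar_val i, ← rowVar_val j]
    exact Ideal.subset_span ⟨i.1, j.1, i.2, j.2, rfl⟩
  · rintro _ ⟨p, q, a, b, rfl⟩
    rcases le_or_gt (r p.1) a with ha | ha
    · simp [rowVar_of_le, ha, ha.trans (Nat.le_succ a)]
    rcases le_or_gt (r q.1) b with hb | hb
    · simp [rowVar_of_le, hb, hb.trans (Nat.le_succ b)]
    refine Ideal.subset_span ⟨⟨p, a, ha⟩, ⟨q, b, hb⟩, ?_⟩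
    rw [det_augmented_jordanMatrix]
    simp [rowVar, ha, hb]

lemma idealQ_eq_truncIdeal (c : K) (hr : Antitone r) {j : Fin l} (hj : r j ≠ 0) :
    idealQ c k r j = truncIdeal (blockSize k r) K {p | p.1 ≤ j} (r j) := by
  have hset : lam₁ k r j ∪ lam₂ k r j = {i | i.1 ∈ {p | p.1 ≤ j} → r j ≤ i.2} := by
    ext i
    by_cases hi : i.1.1 ≤ j <;> simp [lam, lam₁, lam₂, hi]
  have hsize : ∀ p ∈ {p : (i : Fin l) × Fin (k i) | p.1 ≤ j}, r j ≤ blockSize k r p :=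
    fun _ hp => hr hp
  rw [truncIdeal_eq hj hsize, ← hset, Set.image_union, Ideal.span_union,
    ← minorIdeal_jordanMatrix c]
  rfl

lemma idealH_eq_truncIdeal (j : Fin l) :
    idealH K k r j = truncIdeal (blockSize k r) K {p | p.1 ≤ j} 1 := by
  have hset : (theta k r j)ᶜ = {i | i.1 ∈ {p | p.1 ≤ j} → 1 ≤ (i.2 : ℕ)} := by
    ext i
    simp [theta, Nat.one_le_iff_ne_zero]
  rw [truncIdeal_one, ← hset]
  rfl

end Jordan

end Eigenscheme

open Eigenscheme in
theorem mainTheorem2_general {K : Type*} [Field K] (c : K) (l : ℕ) (hl : 1 ≤ l)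
    (k r : Fin l → ℕ) (hr : ∀ i, 1 ≤ r i) (hanti : Antitone r) :
    (minorIdeal (jordanMatrix c k r) = ⨅ j : Fin l, idealQ c k r j) ∧
      ∀ j : Fin l, (idealQ c k r j).IsPrimary ∧ (idealQ c k r j).radical = idealH K k r j := by
  have hr₀ : ∀ j, r j ≠ 0 := fun j => Nat.one_le_iff_ne_zero.1 (hr j)
  have : Nonempty (Fin l) := ⟨⟨0, hl⟩⟩
  simp only [fun j => idealQ_eq_truncIdeal (k := k) c hanti (hr₀ j), minorIdeal_jordanMatrix,
    idealH_eq_truncIdeal]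
  refine ⟨(iInf_truncIdeal hr₀ (fun j p hp => hanti hp) fun S hS => ?_).symm, fun j =>
    ⟨isPrimary_truncIdeal (hr₀ j), radical_truncIdeal (hr₀ j)⟩⟩
  obtain ⟨p, hp, hmax⟩ := S.exists_max_image (fun p => p.1) hS
  exact ⟨p.1, hmax, p, hp, le_rfl⟩

theorem mainTheorem2 {K : Type*} [Field K] (c : K) (l : ℕ) (hl : 1 ≤ l)
    (k r : Fin l → ℕ) (hk : ∀ i, 1 ≤ k i) (hr : ∀ i, 1 ≤ r i) (hanti : StrictAnti r) :
    (Eigenscheme.minorIdeal (Eigenscheme.jordanMatrix c k r)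
        = ⨅ j : Fin l, Eigenscheme.idealQ c k r j) ∧
      ∀ j : Fin l, (Eigenscheme.idealQ c k r j).IsPrimary ∧
        (Eigenscheme.idealQ c k r j).radical = Eigenscheme.idealH K k r j :=
  mainTheorem2_general c l hl k r hr hanti.antitone
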